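/- Let $T>0$, $r>0$, and let $f:[0,T]\times\mathbb R\to\mathbb R$ satisfy the following two conditions. (H1) $f$ is an integrably bounded Carathéodory function: $f(\cdot,x)$ is measurable on $[0,T]$ for every $x\in\mathbb R$, $f(t,\cdot)$ is continuous for a.e. $t\in[0,T]$, and there is $m\in L^1([0,T])$ with $|f(t,x)|\le m(t)$ for all $(t,x)\in[0,T]\times\mathbb R$. (H2) There is $\alpha\in L^1([0,T])$ such that, for a.e. $t\in[0,T]$, $|f(t,x)-f(t,y)|\le\alpha(t)|x-y|$ for all $x,y\in\mathbb R$. Then the impulsive Dirichlet problem in the one-dimensional billiard space $K=[-r,r]$ with elastic reflection at $\pm r$, $$\ddot x(t)=f(t,x(t))\ \text{ for a.e. } t\in[0,T],\qquad \dot x(s+)=-\dot x(s)\ \text{ if } |x(s)|=r,\qquad x(0)=x(T)=0,$$ has infinitely many solutions. Here a solution is a continuous function $x:[0,T]\to[-r,r]$ with $x(0)=x(T)=0$ that has an absolutely continuous derivative on every closed interval of $[0,T]$ on which $|x|<r$, that satisfies $\ddot x(t)=f(t,x(t))$ for a.e. $t\in[0,T]$, and that satisfies the reflection condition at every $s$ with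 $|x(s)|=r$, where $\dot x(s)$ is the derivative from the left and $\dot x(s+)$ is the limit of the velocity from the right. -/

import Mathlib

open Set Filter Topology MeasureTheory

/-- `f` is an integrably bounded Carathéodory function on `[0,T] × ℝ`. Measurability in `t` is
Lebesgue measurability on `[0,T]`. -/
structure IsIntegrablyBoundedCaratheodory (T : ℝ) (f : ℝ → ℝ → ℝ) : Prop where
  measurable_left : ∀ x : ℝ, AEMeasurable (fun t => f t x) (volume.restrict (Icc 0 T))
  continuous_right : ∀ᵐ t ∂(volume.restrict (Icc 0 T)), Continuous (f t)
  bounded : ∃ m : ℝ → ℝ, IntegrableOn m (Icc 0 T) ∧ ∀ t ∈ Icc 0 T, ∀ x : ℝ, |f t x| ≤ m t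

/-- `f` is Lipschitz in the second variable, with an integrable Lipschitz constant. -/
def IsIntegrablyLipschitz (T : ℝ) (f : ℝ → ℝ → ℝ) : Prop :=
  ∃ α : ℝ → ℝ, IntegrableOn α (Icc 0 T) ∧
    ∀ᵐ t ∂(volume.restrict (Icc 0 T)), ∀ x y : ℝ, |f t x - f t y| ≤ α t * |x - y|

/-- The impulse of an absolutely elastic collision on the line: the velocity `v` before the
collision becomes `v + elasticImpulse v = -v`. -/
def elasticImpulse (v : ℝ) : ℝ := -2 * v

/-- The velocity of `x` at time `t`, as the derivative from the left: at a collision time this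
is the velocity before the collision. -/
noncomputable def leftVelocity (x : ℝ → ℝ) (t : ℝ) : ℝ := derivWithin x (Iic t) t

/-- `x`, considered on `[0,T]`, solves the impulsive Dirichlet problem `x'' = f(t,x)`,
`x(0) = x(T) = 0` in the billiard space `K = [-r,r]`, with elastic reflection at `±r`. -/
structure IsBilliardDirichletSolution (T r : ℝ) (f : ℝ → ℝ → ℝ) (x : ℝ → ℝ) : Prop where
  continuousOn : ContinuousOn x (Icc 0 T)
  mem_table : ∀ t ∈ Icc 0 T, x t ∈ Icc (-r) r
  /-- On each interval where `x` is in the interior of `K`, it has an absolutely continuous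
  derivative `w` (one-sided at the end points). -/
  absolutelyContinuous : ∀ a b : ℝ, 0 ≤ a → a < b → b ≤ T →
    (∀ t ∈ Icc a b, x t ∈ Ioo (-r) r) →
      ∃ w : ℝ → ℝ, (∀ t ∈ Icc a b, HasDerivWithinAt x (w t) (Icc a b) t) ∧
        AbsolutelyContinuousOnInterval w a b
  /-- For almost every `t` in `[0,T]`, the second derivative exists and is `f(t,x(t))`. -/
  equation : ∀ᵐ t ∂(volume.restrict (Icc 0 T)),
    (∀ᶠ u in 𝓝 t, DifferentiableAt ℝ x u) ∧ HasDerivAt (deriv x) (f t (x t)) t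
  /-- `x'(s+) = x'(s) + I(x'(s))` whenever `x(s)` is a boundary point of `K`. -/
  impact : ∀ s ∈ Icc 0 T, (x s = r ∨ x s = -r) →
    DifferentiableWithinAt ℝ x (Iic s) s ∧
      Tendsto (leftVelocity x) (𝓝[>] s)
        (𝓝 (leftVelocity x s + elasticImpulse (leftVelocity x s)))
  left_boundary : x 0 = 0
  right_boundary : x T = 0

/-! Unfold the billiard. Reflecting the table at each collision turns `[-r,r]` into the whole line,
with walls at the zeros of the cosine; an elastic bounce becomes a smooth crossing. A solution is
then `x = billiardFold r ∘ y`, where `y'' = G(t,y)` and `G` is the force rescaled and multiplied by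
the orientation `billiardSign y`. Every `y` with `y 0 = 0` and `y T = kπ` folds to `x 0 = x T = 0`,
and different `k` give different initial speeds.

The difficulty is that `G` jumps at the walls. Let `M` be the integral of the bound of `G`. The
velocity varies by at most `M`, so a fast `y` is strictly increasing and meets the countable set of
walls only at countably many, hence negligible, times. Dominated convergence therefore still applies
(`tendsto_trajectory`).

To solve the two-point problem (`exists_trajectory_eq`), delay the equation by `h`. Its solutions
are finite iterations of integrals, continuous in the initial velocity `v`, so the intermediate
value theorem hits `y T = N`. Letting `h → 0`, Arzelà–Ascoli gives a limit that solves the undelayed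
problem. `isBilliardDirichletSolution_billiardFold` folds it back. Large `k` forces initial
velocities beyond any bound, so there are infinitely many solutions. -/

/-! ### Equations with jumps in the state, and their delayed approximations. -/

/-- A right-hand side `G` with an integrable bound `m`, vanishing at negative times, such that
`G t` is continuous off a countable set `S` of states for almost every `t`. -/
structure IsPiecewiseCaratheodory (S : Set ℝ) (m : ℝ → ℝ) (G : ℝ → ℝ → ℝ) : Prop where
  countable : S.Countable
  integrable : Integrable m
  aestronglyMeasurable : ∀ z : ℝ → ℝ, Continuous z →
    AEStronglyMeasurable (fun s => G s (z s)) volume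
  bound : ∀ s y, |G s y| ≤ m s
  continuousAt : ∀ᵐ s, ∀ y, y ∉ S → ContinuousAt (G s) y
  eq_zero : ∀ s < 0, ∀ y, G s y = 0

/-- The velocity at time `τ`, starting from `v`, under the force `G s (z s)`. -/
noncomputable def velocity (G : ℝ → ℝ → ℝ) (v : ℝ) (z : ℝ → ℝ) (τ : ℝ) : ℝ :=
  v + ∫ s in (0 : ℝ)..τ, G s (z s)

/-- The position at time `t`, starting from `0` with velocity `v`, under the force `G s (z s)`. -/
noncomputable def trajectory (G : ℝ → ℝ → ℝ) (v : ℝ) (z : ℝ → ℝ) (t : ℝ) : ℝ :=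
  ∫ τ in (0 : ℝ)..t, velocity G v z τ

/-- Successive approximations for the delay equation `y'' t = G t (y (t - h))`. -/
noncomputable def delayIterate (G : ℝ → ℝ → ℝ) (h v : ℝ) : ℕ → ℝ → ℝ
  | 0 => fun t => v * t
  | j + 1 => trajectory G v (fun s => delayIterate G h v j (s - h))

theorem trajectory_zero (G : ℝ → ℝ → ℝ) (v : ℝ) (z : ℝ → ℝ) : trajectory G v z 0 = 0 := by
  simp [trajectory]

namespace IsPiecewiseCaratheodory

variable {S : Set ℝ} {m : ℝ → ℝ} {G : ℝ → ℝ → ℝ}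

theorem bound_nonneg (hG : IsPiecewiseCaratheodory S m G) (s : ℝ) : 0 ≤ m s :=
  (abs_nonneg _).trans (hG.bound s 0)

theorem integrable_comp (hG : IsPiecewiseCaratheodory S m G) {z : ℝ → ℝ} (hz : Continuous z) :
    Integrable (fun s => G s (z s)) :=
  hG.integrable.mono' (hG.aestronglyMeasurable z hz) (.of_forall fun s => hG.bound s _)

theorem continuous_velocity (hG : IsPiecewiseCaratheodory S m G) {z : ℝ → ℝ} (hz : Continuous z)
    (v : ℝ) : Continuous (velocity G v z) :=
  continuous_const.add (intervalIntegral.continuous_primitive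
    (fun _ _ => (hG.integrable_comp hz).intervalIntegrable) 0)

theorem abs_velocity_sub_le (hG : IsPiecewiseCaratheodory S m G) (z : ℝ → ℝ) (v τ : ℝ) :
    |velocity G v z τ - v| ≤ ∫ s, m s := by
  have h1 : |∫ s in (0 : ℝ)..τ, G s (z s)| ≤ ∫ s in Set.uIoc 0 τ, m s := by
    rw [← Real.norm_eq_abs, intervalIntegral.norm_intervalIntegral_eq]
    exact norm_integral_le_of_norm_le hG.integrable.integrableOn
      (.of_forall fun s => hG.bound s _)
  simpa [velocity] using h1.trans
    (setIntegral_le_integral hG.integrable (.of_forall hG.bound_nonneg))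

theorem hasDerivAt_trajectory (hG : IsPiecewiseCaratheodory S m G) {z : ℝ → ℝ}
    (hz : Continuous z) (v t : ℝ) : HasDerivAt (trajectory G v z) (velocity G v z t) t :=
  intervalIntegral.integral_hasDerivAt_right ((hG.continuous_velocity hz v).intervalIntegrable _ _)
    ((hG.continuous_velocity hz v).stronglyMeasurableAtFilter _ _)
    (hG.continuous_velocity hz v).continuousAt

theorem continuous_trajectory (hG : IsPiecewiseCaratheodory S m G) {z : ℝ → ℝ}
    (hz : Continuous z) (v : ℝ) : Continuous (trajectory G v z) :=
  continuous_iff_continuousAt.2 fun t => (hG.hasDerivAt_trajectory hz v t).continuousAt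

theorem abs_trajectory_sub_sub_le (hG : IsPiecewiseCaratheodory S m G) {z : ℝ → ℝ}
    (hz : Continuous z) (v a b : ℝ) :
    |trajectory G v z b - trajectory G v z a - v * (b - a)| ≤ (∫ s, m s) * |b - a| := by
  have hd : ∀ t, HasDerivAt (fun t => trajectory G v z t - v * t) (velocity G v z t - v) t := by
    intro t
    simpa using (hG.hasDerivAt_trajectory hz v t).fun_sub ((hasDerivAt_id t).const_mul v)
  have := convex_univ.norm_image_sub_le_of_norm_hasDerivWithin_le
    (fun t _ => (hd t).hasDerivWithinAt) (fun t _ => hG.abs_velocity_sub_le z v t)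
    (mem_univ a) (mem_univ b)
  simp only [Real.norm_eq_abs] at this
  convert this using 2
  ring

theorem le_trajectory_sub (hG : IsPiecewiseCaratheodory S m G) {z : ℝ → ℝ}
    (hz : Continuous z) (v : ℝ) {a b : ℝ} (hab : a ≤ b) :
    (v - ∫ s, m s) * (b - a) ≤ trajectory G v z b - trajectory G v z a := by
  have := (abs_le.1 (hG.abs_trajectory_sub_sub_le hz v a b)).1
  rw [abs_of_nonneg (sub_nonneg.2 hab)] at this
  linarith

theorem trajectory_sub_le (hG : IsPiecewiseCaratheodory S m G) {z : ℝ → ℝ}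
    (hz : Continuous z) (v : ℝ) {a b : ℝ} (hab : a ≤ b) :
    trajectory G v z b - trajectory G v z a ≤ (v + ∫ s, m s) * (b - a) := by
  have := (abs_le.1 (hG.abs_trajectory_sub_sub_le hz v a b)).2
  rw [abs_of_nonneg (sub_nonneg.2 hab)] at this
  linarith

theorem strictMono_trajectory (hG : IsPiecewiseCaratheodory S m G) {z : ℝ → ℝ}
    (hz : Continuous z) {v : ℝ} (hv : ∫ s, m s < v) : StrictMono (trajectory G v z) := by
  intro a b hab
  have := hG.le_trajectory_sub hz v hab.le
  have := mul_pos (sub_pos.2 hv) (sub_pos.2 hab)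
  linarith

theorem tendsto_trajectory (hG : IsPiecewiseCaratheodory S m G) {ι : Type*} {l : Filter ι}
    [l.IsCountablyGenerated] {zs : ι → ℝ → ℝ} {z : ℝ → ℝ} {vs : ι → ℝ} {v : ℝ}
    (hzs : ∀ i, Continuous (zs i)) (hinj : Function.Injective z)
    (hlim : ∀ s, Tendsto (fun i => zs i s) l (𝓝 (z s))) (hv : Tendsto vs l (𝓝 v)) (t : ℝ) :
    Tendsto (fun i => trajectory G (vs i) (zs i) t) l (𝓝 (trajectory G v z t)) := by
  -- Only the limit `z` has to avoid the discontinuities; the approximants may meet them on a set of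
  -- positive measure.
  have hS : ∀ᵐ s, z s ∉ S := by
    have : (z ⁻¹' S).Countable := hG.countable.preimage hinj
    exact this.ae_notMem volume
  have hvel : ∀ τ, Tendsto (fun i => velocity G (vs i) (zs i) τ) l (𝓝 (velocity G v z τ)) := by
    intro τ
    refine hv.add (intervalIntegral.tendsto_integral_filter_of_dominated_convergence m
      (.of_forall fun i => (hG.aestronglyMeasurable _ (hzs i)).restrict)
      (.of_forall fun i => .of_forall fun s _ => hG.bound s _)
      hG.integrable.intervalIntegrable ?_)
    filter_upwards [hS, hG.continuousAt] with s hs hc _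
    exact (hc _ hs).tendsto.comp (hlim s)
  refine intervalIntegral.tendsto_integral_filter_of_dominated_convergence
    (fun _ => (|v| + 1) + ∫ s, m s)
    (.of_forall fun i => (hG.continuous_velocity (hzs i) _).aestronglyMeasurable) ?_
    intervalIntegrable_const (.of_forall fun τ _ => hvel τ)
  filter_upwards [hv.abs.eventually (gt_mem_nhds (lt_add_one |v|))] with i hi
  refine .of_forall fun τ _ => ?_
  have h1 := hG.abs_velocity_sub_le (zs i) (vs i) τ
  have h2 := abs_sub_abs_le_abs_sub (velocity G (vs i) (zs i) τ) (vs i)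
  rw [Real.norm_eq_abs]
  linarith

theorem continuous_delayIterate (hG : IsPiecewiseCaratheodory S m G) (h v : ℝ) (j : ℕ) :
    Continuous (delayIterate G h v j) := by
  induction j with
  | zero => exact continuous_const.mul continuous_id
  | succ j ih =>
    exact hG.continuous_trajectory (ih.comp (continuous_id.sub continuous_const)) v

theorem strictMono_delayIterate (hG : IsPiecewiseCaratheodory S m G) (h : ℝ) {v : ℝ}
    (hv : ∫ s, m s < v) (j : ℕ) : StrictMono (delayIterate G h v j) := by
  cases j with
  | zero =>
    have : 0 < v := (integral_nonneg hG.bound_nonneg).trans_lt hv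
    exact fun a b hab => mul_lt_mul_of_pos_left hab this
  | succ j =>
    exact hG.strictMono_trajectory
      ((hG.continuous_delayIterate h v j).comp (continuous_id.sub continuous_const)) hv

/-- The preceding iterate is strictly increasing at this `v`, so the jumps of `G` do no harm in the
limit. -/
theorem continuousAt_delayIterate (hG : IsPiecewiseCaratheodory S m G) (h : ℝ) {v : ℝ}
    (hv : ∫ s, m s < v) (j : ℕ) (t : ℝ) :
    ContinuousAt (fun u => delayIterate G h u j t) v := by
  induction j generalizing t with
  | zero => exact continuousAt_id.mul continuousAt_const
  | succ j ih =>
    exact hG.tendsto_trajectory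
      (fun u => (hG.continuous_delayIterate h u j).comp (continuous_id.sub continuous_const))
      ((hG.strictMono_delayIterate h hv j).injective.comp (sub_left_injective (b := h)))
      (fun s => ih (s - h)) continuousAt_id t

/-- The method of steps: each iteration extends by `h` the range on which the iterates agree. Past
`j * h` is thus the only place where iterate `j + 1` can fail to solve the delay equation. -/
theorem delayIterate_succ_eq (hG : IsPiecewiseCaratheodory S m G) {h : ℝ} (hh : 0 ≤ h) (v : ℝ)
    (j : ℕ) {t : ℝ} (ht : t ≤ j * h) : delayIterate G h v (j + 1) t = delayIterate G h v j t := by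
  have hcongr : ∀ (z₁ z₂ : ℝ → ℝ) (t c : ℝ), 0 ≤ c → t ≤ c →
      (∀ s ≤ c, G s (z₁ s) = G s (z₂ s)) → trajectory G v z₁ t = trajectory G v z₂ t := by
    intro z₁ z₂ t c hc ht hz
    have hle : ∀ t ≤ c, ∀ s ∈ Set.uIcc 0 t, s ≤ c := fun t ht s hs => hs.2.trans (max_le hc ht)
    refine intervalIntegral.integral_congr fun τ hτ => ?_
    simp only [velocity]
    congr 1
    exact intervalIntegral.integral_congr fun s hs => hz s (hle τ (hle t ht τ hτ) s hs)
  induction j generalizing t with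
  | zero =>
    have ht0 : t ≤ 0 := by simpa using ht
    have h0 : ∀ τ ≤ 0, velocity G v (fun s => delayIterate G h v 0 (s - h)) τ = v := by
      intro τ hτ
      have : ∫ s in (0 : ℝ)..τ, G s (delayIterate G h v 0 (s - h)) = ∫ s in (0 : ℝ)..τ, (0 : ℝ) := by
        refine intervalIntegral.integral_congr_ae ?_
        -- `G` vanishes only at strictly negative times, so the end point `0` is discarded as a null
        -- set.
        filter_upwards [(countable_singleton (0 : ℝ)).ae_notMem volume] with s hs0 hs
        rw [uIoc_of_ge hτ] at hs
        exact hG.eq_zero s (lt_of_le_of_ne hs.2 hs0) _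
      simp only [velocity, this]
      simp
    have : trajectory G v (fun s => delayIterate G h v 0 (s - h)) t = ∫ τ in (0 : ℝ)..t, v := by
      refine intervalIntegral.integral_congr fun τ hτ => h0 τ (hτ.2.trans (max_le le_rfl ht0))
    simp only [delayIterate] at this ⊢
    rw [this]
    simp [mul_comm]
  | succ j ih =>
    refine hcongr _ _ t _ (by positivity) ht fun s hs => ?_
    rw [ih]
    push_cast at hs
    linarith

end IsPiecewiseCaratheodory

/-! ### Compactness and the two-point problem. -/

theorem isCompact_setOf_lipschitzWith_of_map_zero (K : NNReal) :
    IsCompact {u : C(ℝ, ℝ) | u 0 = 0 ∧ LipschitzWith K u} := by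
  refine ArzelaAscoli.isCompact_of_equicontinuous _ ?_ ?_
  · have himg : ContinuousMap.toFun '' {u : C(ℝ, ℝ) | u 0 = 0 ∧ LipschitzWith K u} =
        {u : ℝ → ℝ | u 0 = 0} ∩ {u : ℝ → ℝ | LipschitzWith K u} := by
      ext u
      constructor
      · rintro ⟨w, hw, rfl⟩
        exact hw
      · rintro ⟨h0, hL⟩
        exact ⟨⟨u, hL.continuous⟩, ⟨h0, hL⟩, rfl⟩
    rw [himg]
    refine (isCompact_univ_pi fun t : ℝ => isCompact_Icc (a := -(K * |t|)) (b := K * |t|))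
      |>.of_isClosed_subset ?_ ?_
    · refine (isClosed_eq (continuous_apply 0) continuous_const).inter ?_
      simp only [lipschitzWith_iff_dist_le_mul, ofPred_forall]
      refine isClosed_iInter fun a => isClosed_iInter fun b => ?_
      exact isClosed_le ((continuous_apply a).dist (continuous_apply b)) continuous_const
    · rintro u ⟨h0, hL⟩ t -
      have := hL.dist_le_mul t 0
      rw [mem_ofPred_eq] at h0
      rw [h0, Real.dist_eq, Real.dist_eq, sub_zero, sub_zero] at this
      exact abs_le.1 this
  · refine LipschitzWith.uniformEquicontinuous _ K (fun u => u.2.2) |>.equicontinuous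

namespace IsPiecewiseCaratheodory

variable {S : Set ℝ} {m : ℝ → ℝ} {G : ℝ → ℝ → ℝ}

theorem exists_delayIterate_eq (hG : IsPiecewiseCaratheodory S m G) {T N : ℝ} (hT : 0 < T)
    (hN : 2 * ∫ s, m s < N / T) (h : ℝ) (j : ℕ) :
    ∃ v ∈ Icc (N / T - ∫ s, m s) (N / T + ∫ s, m s), delayIterate G h v (j + 1) T = N := by
  have hM : 0 ≤ ∫ s, m s := integral_nonneg hG.bound_nonneg
  have hcz : ∀ v, Continuous fun s => delayIterate G h v j (s - h) := fun v =>
    (hG.continuous_delayIterate h v j).comp (continuous_id.sub continuous_const)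
  have key := intermediate_value_Icc (f := fun v => delayIterate G h v (j + 1) T)
    (show N / T - ∫ s, m s ≤ N / T + ∫ s, m s by linarith)
    (fun v hv => (hG.continuousAt_delayIterate h (by linarith [hv.1]) (j + 1) T).continuousWithinAt)
  have hNT : N / T * T = N := div_mul_cancel₀ _ hT.ne'
  -- With `v = N / T - M` the slope never exceeds `N / T`, and with `v = N / T + M` it never falls
  -- below it.
  refine key ⟨?_, ?_⟩
  · have := hG.trajectory_sub_le (hcz (N / T - ∫ s, m s)) (N / T - ∫ s, m s) hT.le
    rw [trajectory_zero] at this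
    simp only [delayIterate]
    linarith
  · have := hG.le_trajectory_sub (hcz (N / T + ∫ s, m s)) (N / T + ∫ s, m s) hT.le
    rw [trajectory_zero] at this
    simp only [delayIterate]
    linarith

/-- The Dirichlet problem `y'' = G (t, y)`, `y 0 = 0`, `y T = N` has an increasing solution if
`N` is large. -/
theorem exists_trajectory_eq (hG : IsPiecewiseCaratheodory S m G) {T N : ℝ} (hT : 0 < T)
    (hN : 2 * ∫ s, m s < N / T) :
    ∃ (v : ℝ) (y : ℝ → ℝ), N / T - ∫ s, m s ≤ v ∧ Continuous y ∧ y T = N ∧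
      trajectory G v y = y := by
  have hM : 0 ≤ ∫ s, m s := integral_nonneg hG.bound_nonneg
  set M := ∫ s, m s with hMdef
  let h : ℕ → ℝ := fun n => 1 / ((n : ℝ) + 1)
  -- With this choice `j n * h n = n + 1`, so the range on which the delay equation holds exhausts
  -- the line.
  let j : ℕ → ℕ := fun n => (n + 1) ^ 2
  have hh : ∀ n, 0 ≤ h n := fun n => by positivity
  choose v hv hvN using fun n => hG.exists_delayIterate_eq hT hN (h n) (j n)
  have hcz : ∀ n, Continuous fun s => delayIterate G (h n) (v n) (j n) (s - h n) := fun n =>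
    (hG.continuous_delayIterate _ _ _).comp (continuous_id.sub continuous_const)
  let u : ℕ → C(ℝ, ℝ) := fun n =>
    ⟨delayIterate G (h n) (v n) (j n + 1), hG.continuous_delayIterate _ _ _⟩
  have hu : ∀ n t, u n t =
      trajectory G (v n) (fun s => delayIterate G (h n) (v n) (j n) (s - h n)) t :=
    fun n t => rfl
  let K : NNReal := ⟨N / T + M + M, by linarith⟩
  -- One `M` comes from the range of `v n`, the other from the force. The lower slope is positive by
  -- `hN`, so strict monotonicity survives in the limit.
  have hslope : ∀ n a b, a ≤ b →
      (N / T - M - M) * (b - a) ≤ u n b - u n a ∧ u n b - u n a ≤ K * (b - a) := by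
    intro n a b hab
    rw [hu, hu]
    have h1 := hG.le_trajectory_sub (hcz n) (v n) hab
    have h2 := hG.trajectory_sub_le (hcz n) (v n) hab
    have h3 := mul_le_mul_of_nonneg_right (hv n).1 (sub_nonneg.2 hab)
    have h4 := mul_le_mul_of_nonneg_right (hv n).2 (sub_nonneg.2 hab)
    have hK : (K : ℝ) = N / T + M + M := rfl
    rw [hK]
    constructor <;> linarith
  have huL : ∀ n, LipschitzWith K (u n) := by
    intro n
    refine LipschitzWith.of_le_add_mul K fun a b => ?_
    rw [Real.dist_eq]
    rcases le_total a b with hab | hab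
    · have h1 := (hslope n a b hab).1
      have : 0 ≤ (N / T - M - M) * (b - a) := mul_nonneg (by linarith) (by linarith)
      have : 0 ≤ (K : ℝ) * |a - b| := by positivity
      linarith
    · have h1 := (hslope n b a hab).2
      rw [abs_of_nonneg (by linarith)]
      linarith
  have humem : ∀ n, (u n, v n) ∈ {u : C(ℝ, ℝ) | u 0 = 0 ∧ LipschitzWith K u} ×ˢ
      Icc (N / T - M) (N / T + M) :=
    fun n => ⟨⟨by rw [hu, trajectory_zero], huL n⟩, hv n⟩
  obtain ⟨⟨y, w⟩, hyw, φ, hφ, hlim⟩ :=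
    ((isCompact_setOf_lipschitzWith_of_map_zero K).prod isCompact_Icc).tendsto_subseq humem
  have hlimv : Tendsto (fun n => v (φ n)) atTop (𝓝 w) :=
    (continuous_snd.tendsto _).comp hlim
  have hlimu : ∀ t, Tendsto (fun n => u (φ n) t) atTop (𝓝 (y t)) := fun t =>
    (((ContinuousEvalConst.continuous_eval_const t).comp continuous_fst).tendsto (y, w)).comp hlim
  have hymono : StrictMono y := by
    intro a b hab
    have h1 : (N / T - M - M) * (b - a) ≤ y b - y a :=
      ge_of_tendsto' ((hlimu b).sub (hlimu a)) fun n => (hslope _ a b hab.le).1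
    have h2 : 0 < (N / T - M - M) * (b - a) := mul_pos (by linarith) (by linarith)
    linarith
  have hh0 : Tendsto (fun n => h (φ n)) atTop (𝓝 0) :=
    tendsto_one_div_add_atTop_nhds_zero_nat.comp hφ.tendsto_atTop
  have hdelay : ∀ s, Tendsto
      (fun n => delayIterate G (h (φ n)) (v (φ n)) (j (φ n)) (s - h (φ n))) atTop (𝓝 (y s)) := by
    -- The common Lipschitz constant absorbs the shift by `h`; for large `n`, iterates `j` and `j +
    -- 1` agree at `s - h`.
    intro s
    have hshift : Tendsto (fun n => u (φ n) (s - h (φ n))) atTop (𝓝 (y s)) := by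
      have hd : Tendsto (fun n => u (φ n) (s - h (φ n)) - u (φ n) s) atTop (𝓝 0) := by
        refine squeeze_zero_norm (a := fun n => K * h (φ n)) (fun n => ?_) ?_
        · have := (huL (φ n)).dist_le_mul (s - h (φ n)) s
          rw [← dist_eq_norm]
          refine this.trans_eq ?_
          rw [Real.dist_eq, sub_sub_cancel_left, abs_neg, abs_of_nonneg (hh _)]
        · simpa using hh0.const_mul (K : ℝ)
      simpa using hd.add (hlimu s)
    refine hshift.congr' ?_
    filter_upwards [(tendsto_natCast_atTop_atTop.comp hφ.tendsto_atTop).eventually_ge_atTop s]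
      with n hn
    refine hG.delayIterate_succ_eq (hh _) _ _ ?_
    have h1 : ((j (φ n) : ℕ) : ℝ) * h (φ n) = (φ n : ℝ) + 1 := by
      simp only [j, h]
      push_cast
      field_simp
    rw [h1]
    have := hh (φ n)
    simp only [Function.comp_apply] at hn
    linarith
  refine ⟨w, y, hyw.2.1, y.continuous, ?_, ?_⟩
  · refine tendsto_nhds_unique (hlimu T) ?_
    simp only [show ∀ n, u n T = N from hvN]
    exact tendsto_const_nhds
  · funext t
    exact tendsto_nhds_unique
      (hG.tendsto_trajectory (fun n => hcz (φ n)) hymono.injective hdelay hlimv t) (hlimu t)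

end IsPiecewiseCaratheodory

/-! ### Geometry of the folding. -/

/-- The folding of the line onto `[-r,r]` by reflections at `±r`; the line is scaled so that the
walls are the zeros of the cosine. -/
noncomputable def billiardFold (r θ : ℝ) : ℝ := 2 * r / Real.pi * Real.arcsin (Real.sin θ)

/-- The orientation of the folding, `0` at the walls. -/
noncomputable def billiardSign (θ : ℝ) : ℝ := (SignType.sign (Real.cos θ) : ℝ)

theorem continuous_billiardFold (r : ℝ) : Continuous (billiardFold r) :=
  continuous_const.mul (Real.continuous_arcsin.comp Real.continuous_sin)

theorem billiardFold_mem_Icc {r : ℝ} (hr : 0 < r) (θ : ℝ) : billiardFold r θ ∈ Icc (-r) r := by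
  have hc : 0 < 2 * r / Real.pi := by positivity
  have h1 := mul_le_mul_of_nonneg_left (Real.neg_pi_div_two_le_arcsin (Real.sin θ)) hc.le
  have h2 := mul_le_mul_of_nonneg_left (Real.arcsin_le_pi_div_two (Real.sin θ)) hc.le
  have h3 : 2 * r / Real.pi * (Real.pi / 2) = r := by field_simp
  have h4 : 2 * r / Real.pi * -(Real.pi / 2) = -r := by rw [mul_neg, h3]
  rw [h4] at h1
  rw [h3] at h2
  exact ⟨h1, h2⟩

theorem billiardFold_eq_or_eq_neg_iff {r : ℝ} (hr : 0 < r) (θ : ℝ) :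
    (billiardFold r θ = r ∨ billiardFold r θ = -r) ↔ Real.cos θ = 0 := by
  have hc : 2 * r / Real.pi ≠ 0 := by positivity
  have h3 : 2 * r / Real.pi * (Real.pi / 2) = r := by field_simp
  have h4 : 2 * r / Real.pi * -(Real.pi / 2) = -r := by rw [mul_neg, h3]
  have e1 : billiardFold r θ = r ↔ Real.sin θ = 1 := by
    rw [billiardFold]
    conv_lhs => rhs; rw [← h3]
    rw [mul_right_inj' hc, Real.arcsin_eq_pi_div_two]
    exact ⟨fun h => le_antisymm (Real.sin_le_one θ) h, fun h => h.ge⟩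
  have e2 : billiardFold r θ = -r ↔ Real.sin θ = -1 := by
    rw [billiardFold]
    conv_lhs => rhs; rw [← h4]
    rw [mul_right_inj' hc, Real.arcsin_eq_neg_pi_div_two]
    exact ⟨fun h => le_antisymm h (Real.neg_one_le_sin θ), fun h => h.le⟩
  rw [e1, e2, Real.cos_eq_zero_iff_sin_eq]

theorem hasDerivAt_billiardFold (r : ℝ) {θ : ℝ} (hθ : Real.cos θ ≠ 0) :
    HasDerivAt (billiardFold r) (2 * r / Real.pi * billiardSign θ) θ := by
  have hsq := Real.sin_sq_add_cos_sq θ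
  have hpos : 0 < Real.cos θ ^ 2 := by positivity
  have h1 : Real.sin θ ≠ -1 := fun h => by rw [h] at hsq; linarith
  have h2 : Real.sin θ ≠ 1 := fun h => by rw [h] at hsq; linarith
  have := ((Real.hasDerivAt_arcsin h1 h2).comp θ (Real.hasDerivAt_sin θ)).const_mul
    (2 * r / Real.pi)
  refine this.congr_deriv ?_
  congr 1
  rw [← Real.cos_sq', Real.sqrt_sq_eq_abs, billiardSign, one_div, inv_mul_eq_div]
  rcases hθ.lt_or_gt with h | h
  · rw [sign_neg h, abs_of_neg h, div_neg, div_self hθ]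
    simp
  · rw [sign_pos h, abs_of_pos h, div_self hθ]
    simp

theorem billiardSign_sq {θ : ℝ} (hθ : Real.cos θ ≠ 0) : billiardSign θ * billiardSign θ = 1 := by
  rcases hθ.lt_or_gt with h | h
  · simp [billiardSign, sign_neg h]
  · simp [billiardSign, sign_pos h]

theorem abs_billiardSign_le_one (θ : ℝ) : |billiardSign θ| ≤ 1 := by
  rcases lt_trichotomy (Real.cos θ) 0 with h | h | h
  · simp [billiardSign, sign_neg h]
  · simp [billiardSign, h]
  · simp [billiardSign, sign_pos h]

theorem measurable_billiardSign : Measurable billiardSign := by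
  have : billiardSign = fun θ => if 0 < Real.cos θ then 1 else if Real.cos θ < 0 then -1 else 0 := by
    funext θ
    rw [billiardSign, sign_apply]
    split_ifs <;> simp
  rw [this]
  exact Measurable.ite (measurableSet_lt measurable_const Real.measurable_cos) measurable_const
    (Measurable.ite (measurableSet_lt Real.measurable_cos measurable_const) measurable_const
      measurable_const)

theorem billiardSign_eventuallyEq {θ : ℝ} (hθ : Real.cos θ ≠ 0) :
    ∀ᶠ u in 𝓝 θ, billiardSign u = billiardSign θ := by
  rcases hθ.lt_or_gt with h | h
  · filter_upwards [Real.continuous_cos.continuousAt.eventually (gt_mem_nhds h)] with u hu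
    rw [billiardSign, billiardSign, sign_neg h, sign_neg hu]
  · filter_upwards [Real.continuous_cos.continuousAt.eventually (lt_mem_nhds h)] with u hu
    rw [billiardSign, billiardSign, sign_pos h, sign_pos hu]

/-- At a wall `sin θ = ±1`, and this is the orientation just before it; just after it the
orientation is the opposite. This change of sign is the elastic reflection. -/
theorem cos_ne_zero_and_billiardSign_left {θ : ℝ} (hθ : Real.cos θ = 0) :
    ∀ᶠ u in 𝓝[<] θ, Real.cos u ≠ 0 ∧ billiardSign u = Real.sin θ := by
  filter_upwards [Ioo_mem_nhdsLT (show θ - Real.pi < θ by linarith [Real.pi_pos])] with u hu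
  have hs : 0 < Real.sin (θ - u) := Real.sin_pos_of_pos_of_lt_pi (by linarith [hu.2])
    (by linarith [hu.1])
  have hcu : Real.cos u = Real.sin θ * Real.sin (θ - u) := by
    have := Real.cos_sub θ (θ - u)
    rwa [hθ, zero_mul, zero_add, sub_sub_cancel] at this
  rcases Real.cos_eq_zero_iff_sin_eq.1 hθ with h | h
  · rw [h, one_mul] at hcu
    rw [← hcu] at hs
    exact ⟨hs.ne', by simp [billiardSign, sign_pos hs, h]⟩
  · have hs' : Real.cos u < 0 := by rw [hcu, h]; linarith
    exact ⟨hs'.ne, by simp [billiardSign, sign_neg hs', h]⟩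

theorem cos_ne_zero_and_billiardSign_right {θ : ℝ} (hθ : Real.cos θ = 0) :
    ∀ᶠ u in 𝓝[>] θ, Real.cos u ≠ 0 ∧ billiardSign u = -Real.sin θ := by
  filter_upwards [Ioo_mem_nhdsGT (show θ < θ + Real.pi by linarith [Real.pi_pos])] with u hu
  have hs : 0 < Real.sin (u - θ) := Real.sin_pos_of_pos_of_lt_pi (by linarith [hu.1])
    (by linarith [hu.2])
  have hcu : Real.cos u = -(Real.sin θ * Real.sin (u - θ)) := by
    have := Real.cos_add θ (u - θ)
    rwa [hθ, zero_mul, zero_sub, add_sub_cancel] at this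
  rcases Real.cos_eq_zero_iff_sin_eq.1 hθ with h | h
  · have hs' : Real.cos u < 0 := by rw [hcu, h]; linarith
    exact ⟨hs'.ne, by simp [billiardSign, sign_neg hs', h]⟩
  · have hs' : 0 < Real.cos u := by rw [hcu, h]; linarith
    exact ⟨hs'.ne', by simp [billiardSign, sign_pos hs', h]⟩

theorem countable_setOf_cos_eq_zero : {θ : ℝ | Real.cos θ = 0}.Countable := by
  refine (countable_range fun k : ℤ => (2 * (k : ℝ) + 1) * Real.pi / 2).mono fun θ hθ => ?_
  obtain ⟨k, hk⟩ := Real.cos_eq_zero_iff.1 hθ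
  exact ⟨k, hk.symm⟩

theorem billiardSign_eq_of_mem_Icc {y : ℝ → ℝ} (hy : Continuous y) {a b : ℝ}
    (h : ∀ t ∈ Icc a b, Real.cos (y t) ≠ 0) {s t : ℝ} (hs : s ∈ Icc a b) (ht : t ∈ Icc a b) :
    billiardSign (y s) = billiardSign (y t) := by
  have hc : ContinuousOn (fun t => SignType.sign (Real.cos (y t))) (Icc a b) := fun t ht =>
    (ContinuousAt.comp (f := fun t => Real.cos (y t)) (continuousAt_sign_of_ne_zero (h t ht))
      (Real.continuous_cos.comp hy).continuousAt).continuousWithinAt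
  simp only [billiardSign]
  rw [isPreconnected_Icc.constant hc hs ht]

/-! ### The unfolded force. -/

/-- The force of the unfolded billiard. -/
noncomputable def unfoldedForce (T r : ℝ) (f : ℝ → ℝ → ℝ) (s θ : ℝ) : ℝ :=
  (Icc 0 T).indicator
    (fun s => Real.pi / (2 * r) * billiardSign θ * f s (billiardFold r θ)) s

/-- Approximate `z` by simple functions: on each fibre the state is a constant, and continuity in
the state passes to the limit. -/
theorem IsIntegrablyBoundedCaratheodory.aemeasurable_comp {T : ℝ} {f : ℝ → ℝ → ℝ}
    (hf : IsIntegrablyBoundedCaratheodory T f) {z : ℝ → ℝ} (hz : Measurable z) :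
    AEMeasurable (fun s => f s (z s)) (volume.restrict (Icc 0 T)) := by
  let zs := hz.stronglyMeasurable.approx
  refine aemeasurable_of_tendsto_metrizable_ae atTop (f := fun n s => f s (zs n s)) (fun n => ?_) ?_
  · have hcover : (⋃ c : (zs n).range, zs n ⁻¹' {(c : ℝ)}) = univ := by
      refine eq_univ_of_forall fun s => mem_iUnion.2 ⟨⟨zs n s, (zs n).mem_range_self s⟩, rfl⟩
    rw [← Measure.restrict_univ (μ := volume.restrict (Icc 0 T)), ← hcover,
      aemeasurable_iUnion_iff]
    intro c
    refine (hf.measurable_left c).restrict.congr ?_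
    filter_upwards [ae_restrict_mem ((zs n).measurableSet_fiber c)] with s hs
    rw [show zs n s = c from hs]
  · filter_upwards [hf.continuous_right] with s hs
    exact (hs.tendsto _).comp (hz.stronglyMeasurable.tendsto_approx s)

theorem IsIntegrablyBoundedCaratheodory.unfoldedForce {T r : ℝ} (hr : 0 < r) {f : ℝ → ℝ → ℝ}
    (hf : IsIntegrablyBoundedCaratheodory T f) :
    ∃ m, IsPiecewiseCaratheodory {θ | Real.cos θ = 0} m (unfoldedForce T r f) := by
  obtain ⟨m, hm, hfm⟩ := hf.bounded
  have hc : 0 < Real.pi / (2 * r) := by positivity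
  refine ⟨(Icc 0 T).indicator fun s => Real.pi / (2 * r) * m s, countable_setOf_cos_eq_zero,
    IntegrableOn.integrable_indicator (Integrable.const_mul hm _) measurableSet_Icc, ?_, ?_, ?_, ?_⟩
  · intro z hz
    have h1 := hf.aemeasurable_comp ((continuous_billiardFold r).comp hz).measurable
    have h2 : Measurable fun s => Real.pi / (2 * r) * billiardSign (z s) :=
      (measurable_billiardSign.comp hz.measurable).const_mul _
    exact ((aemeasurable_indicator_iff measurableSet_Icc).2
      (h2.aemeasurable.mul h1)).aestronglyMeasurable
  · intro s y
    simp only [_root_.unfoldedForce]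
    by_cases hs : s ∈ Icc 0 T
    · rw [indicator_of_mem hs, indicator_of_mem hs, abs_mul, abs_mul, abs_of_pos hc, mul_assoc]
      refine mul_le_mul_of_nonneg_left ?_ hc.le
      exact (mul_le_of_le_one_left (abs_nonneg _) (abs_billiardSign_le_one y)).trans (hfm s hs _)
    · rw [indicator_of_notMem hs, indicator_of_notMem hs, abs_zero]
  · filter_upwards [(ae_restrict_iff' measurableSet_Icc).1 hf.continuous_right] with s hs y hy
    by_cases hsT : s ∈ Icc 0 T
    · have he : _root_.unfoldedForce T r f s =
          fun θ => Real.pi / (2 * r) * billiardSign θ * f s (billiardFold r θ) :=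
        funext fun θ => indicator_of_mem hsT _
      rw [he]
      have h1 : ContinuousAt billiardSign y :=
        (continuousAt_const (y := billiardSign y)).congr
          ((billiardSign_eventuallyEq hy).mono fun u hu => hu.symm)
      exact (continuousAt_const.mul h1).mul
        ((hs hsT).comp (continuous_billiardFold r)).continuousAt
    · have he : _root_.unfoldedForce T r f s = fun _ => 0 :=
        funext fun θ => indicator_of_notMem hsT _
      rw [he]
      exact continuousAt_const
  · intro s hs y
    exact indicator_of_notMem (fun h => absurd h.1 (not_le.2 hs)) _

/-! ### Folding back to the billiard. -/

theorem isBilliardDirichletSolution_billiardFold {T r : ℝ} (hT : 0 < T) (hr : 0 < r)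
    {f : ℝ → ℝ → ℝ} {m : ℝ → ℝ} {v : ℝ} {y : ℝ → ℝ} {k : ℕ}
    (hG : IsPiecewiseCaratheodory {θ | Real.cos θ = 0} m (unfoldedForce T r f))
    (hv : ∫ s, m s < v) (hy : Continuous y) (hyT : y T = k * Real.pi)
    (htraj : trajectory (unfoldedForce T r f) v y = y) :
    IsBilliardDirichletSolution T r f (IccExtend hT.le fun t => billiardFold r (y t)) := by
  set G := unfoldedForce T r f with hGdef
  set x := IccExtend hT.le fun t => billiardFold r (y t) with hx
  set c := 2 * r / Real.pi with hc
  have hw : Continuous (velocity G v y) := hG.continuous_velocity hy v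
  have hmono : StrictMono y := htraj ▸ hG.strictMono_trajectory hy hv
  have hy0 : y 0 = 0 := by rw [← htraj, trajectory_zero]
  have hyderiv : ∀ t, HasDerivAt y (velocity G v y t) t := fun t => by
    simpa only [htraj] using hG.hasDerivAt_trajectory hy v t
  have hxeq : ∀ t ∈ Icc 0 T, x t = billiardFold r (y t) := fun t ht => IccExtend_of_mem _ _ ht
  have hxnhds : ∀ t ∈ Ioo 0 T, x =ᶠ[𝓝 t] fun t => billiardFold r (y t) := fun t ht => by
    filter_upwards [Icc_mem_nhds ht.1 ht.2] with u hu using hxeq u hu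
  have hXderiv : ∀ t, Real.cos (y t) ≠ 0 → HasDerivAt (fun t => billiardFold r (y t))
      (c * billiardSign (y t) * velocity G v y t) t :=
    fun t ht => (hasDerivAt_billiardFold r ht).comp t (hyderiv t)
  have hxderiv : ∀ t ∈ Ioo 0 T, Real.cos (y t) ≠ 0 →
      HasDerivAt x (c * billiardSign (y t) * velocity G v y t) t :=
    fun t ht hct => (hXderiv t hct).congr_of_eventuallyEq (hxnhds t ht)
  have hwall : ∀ t ∈ Icc 0 T, ((x t = r ∨ x t = -r) ↔ Real.cos (y t) = 0) := fun t ht => by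
    rw [hxeq t ht, billiardFold_eq_or_eq_neg_iff hr]
  have hsinT : Real.sin (y T) = 0 := by rw [hyT, Real.sin_nat_mul_pi]
  have hcont : Continuous x :=
    (((continuous_billiardFold r).comp hy).comp continuous_subtype_val).Icc_extend'
  refine ⟨hcont.continuousOn, fun t ht => hxeq t ht ▸ billiardFold_mem_Icc hr _, ?_, ?_, ?_, ?_, ?_⟩
  · intro a b ha hab hb hin
    have hsub : Icc a b ⊆ Icc 0 T := Icc_subset_Icc ha hb
    have hne : ∀ t ∈ Icc a b, Real.cos (y t) ≠ 0 := fun t ht h0 => by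
      have h1 := hin t ht
      rcases (hwall t (hsub ht)).2 h0 with h | h
      · exact h1.2.ne h
      · exact h1.1.ne' h
    refine ⟨fun t => c * billiardSign (y a) * velocity G v y t, fun t ht => ?_, ?_⟩
    · rw [billiardSign_eq_of_mem_Icc hy hne (left_mem_Icc.2 hab.le) ht]
      exact (hXderiv t (hne t ht)).hasDerivWithinAt.congr (fun u hu => hxeq u (hsub hu))
        (hxeq t (hsub ht))
    · refine AbsolutelyContinuousOnInterval.const_mul _ ?_
      have h1 : AbsolutelyContinuousOnInterval (fun _ : ℝ => v) a b :=
        (LipschitzWith.const v).lipschitzOnWith.absolutelyContinuousOnInterval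
      have h2 : AbsolutelyContinuousOnInterval (fun τ => ∫ s in (0 : ℝ)..τ, G s (y s)) 0 T :=
        (hG.integrable_comp hy).intervalIntegrable.absolutelyContinuousOnInterval_intervalIntegral
          left_mem_uIcc
      refine h1.add (h2.mono ?_)
      rwa [uIcc_of_le hab.le, uIcc_of_le hT.le]
  · rw [ae_restrict_iff' measurableSet_Icc]
    have hnull : ∀ᵐ t : ℝ, Real.cos (y t) ≠ 0 :=
      (countable_setOf_cos_eq_zero.preimage hmono.injective).ae_notMem volume
    -- Almost every time is a Lebesgue point of the force and no collision. The end points go too,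
    -- since `IccExtend` is constant beyond them.
    filter_upwards [hnull, LocallyIntegrable.ae_hasDerivAt_integral (hG.integrable_comp hy).locallyIntegrable,
      (countable_singleton (0 : ℝ)).ae_notMem volume,
      (countable_singleton T).ae_notMem volume] with t hct hLeb ht0 htT ht
    have htI : t ∈ Ioo 0 T := ⟨lt_of_le_of_ne ht.1 (Ne.symm ht0), lt_of_le_of_ne ht.2 htT⟩
    have hev : ∀ᶠ u in 𝓝 t, HasDerivAt x (c * billiardSign (y t) * velocity G v y u) u := by
      filter_upwards [isOpen_Ioo.mem_nhds htI, hy.continuousAt.eventually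
        (billiardSign_eventuallyEq hct), (Real.continuous_cos.comp hy).continuousAt.eventually_ne hct]
        with u hu hsu hcu
      rw [← hsu]
      exact hxderiv u hu hcu
    refine ⟨hev.mono fun u hu => hu.differentiableAt, ?_⟩
    have hd : HasDerivAt (fun u => c * billiardSign (y t) * velocity G v y u)
        (c * billiardSign (y t) * G t (y t)) t := ((hLeb 0).const_add v).const_mul _
    have hval : c * billiardSign (y t) * G t (y t) = f t (x t) := by
      rw [hxeq t ht, hGdef, unfoldedForce, indicator_of_mem ht, hc]
      have := billiardSign_sq hct
      calc _ = (2 * r / Real.pi * (Real.pi / (2 * r))) *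
            (billiardSign (y t) * billiardSign (y t)) * f t (billiardFold r (y t)) := by ring
        _ = _ := by
          rw [this, show 2 * r / Real.pi * (Real.pi / (2 * r)) = 1 by field_simp]
          ring
    rw [← hval]
    exact hd.congr_of_eventuallyEq (hev.mono fun u hu => hu.deriv)
  · intro s hs hxs
    have hcs : Real.cos (y s) = 0 := (hwall s hs).1 hxs
    have hs0 : s ≠ 0 := by
      rintro rfl
      rw [hy0, Real.cos_zero] at hcs
      exact one_ne_zero hcs
    -- No collision occurs at `0` or `T`, so both one-sided limits are taken inside the time
    -- interval.
    have hsT : s ≠ T := by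
      rintro rfl
      have := Real.sin_sq_add_cos_sq (y s)
      rw [hcs, hsinT] at this
      norm_num at this
    have hsI : s ∈ Ioo 0 T := ⟨lt_of_le_of_ne hs.1 hs0.symm, lt_of_le_of_ne hs.2 hsT⟩
    have hyl : Tendsto y (𝓝[<] s) (𝓝[<] y s) :=
      tendsto_nhdsWithin_of_tendsto_nhds_of_eventually_within _
        (hy.continuousAt.tendsto.mono_left nhdsWithin_le_nhds)
        (eventually_mem_nhdsWithin.mono fun u hu => hmono hu)
    have hyr : Tendsto y (𝓝[>] s) (𝓝[>] y s) :=
      tendsto_nhdsWithin_of_tendsto_nhds_of_eventually_within _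
        (hy.continuousAt.tendsto.mono_left nhdsWithin_le_nhds)
        (eventually_mem_nhdsWithin.mono fun u hu => hmono hu)
    have hleft : ∀ᶠ u in 𝓝[<] s, HasDerivAt x (c * Real.sin (y s) * velocity G v y u) u := by
      filter_upwards [hyl.eventually (cos_ne_zero_and_billiardSign_left hcs),
        mem_nhdsWithin_of_mem_nhds (isOpen_Ioo.mem_nhds hsI)] with u hu huI
      rw [← hu.2]
      exact hxderiv u huI hu.1
    have hright : ∀ᶠ u in 𝓝[>] s, HasDerivAt x (c * -Real.sin (y s) * velocity G v y u) u := by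
      filter_upwards [hyr.eventually (cos_ne_zero_and_billiardSign_right hcs),
        mem_nhdsWithin_of_mem_nhds (isOpen_Ioo.mem_nhds hsI)] with u hu huI
      rw [← hu.2]
      exact hxderiv u huI hu.1
    have hlim : ∀ (C : ℝ) (l : Filter ℝ), l ≤ 𝓝 s → Tendsto (fun u => C * velocity G v y u) l
        (𝓝 (C * velocity G v y s)) := fun C l hl =>
      ((continuous_const.mul hw).tendsto s).mono_left hl
    -- A limit of the derivative from the left is the left derivative of a continuous function.
    have hA : HasDerivWithinAt x (c * Real.sin (y s) * velocity G v y s) (Iic s) s := by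
      refine hasDerivWithinAt_Iic_of_tendsto_deriv
        (s := {u | HasDerivAt x (c * Real.sin (y s) * velocity G v y u) u})
        (fun u hu => (HasDerivAt.differentiableAt hu).differentiableWithinAt)
        hcont.continuousWithinAt hleft ?_
      exact (hlim _ _ nhdsWithin_le_nhds).congr' (hleft.mono fun u hu => hu.deriv.symm)
    refine ⟨hA.differentiableWithinAt, ?_⟩
    rw [leftVelocity, hA.derivWithin (uniqueDiffWithinAt_Iic s), elasticImpulse]
    have := (hlim (c * -Real.sin (y s)) _ nhdsWithin_le_nhds).congr' (hright.mono fun u hu =>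
      (hu.hasDerivWithinAt.derivWithin (uniqueDiffWithinAt_Iic u)).symm)
    have he : c * Real.sin (y s) * velocity G v y s +
        -2 * (c * Real.sin (y s) * velocity G v y s) =
        c * -Real.sin (y s) * velocity G v y s := by ring
    rwa [he]
  · rw [hxeq 0 (left_mem_Icc.2 hT.le), hy0]
    simp [billiardFold]
  · rw [hxeq T (right_mem_Icc.2 hT.le), billiardFold, hsinT]
    simp

/-- The initial velocity can be read off from `x`, which distinguishes the solutions. It is taken
from the right because the extension is constant before `0`. -/
theorem derivWithin_billiardFold_trajectory {T : ℝ} (hT : 0 < T) (r : ℝ) {G : ℝ → ℝ → ℝ}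
    {S : Set ℝ} {m : ℝ → ℝ} {v : ℝ} {y : ℝ → ℝ} (hG : IsPiecewiseCaratheodory S m G)
    (hy : Continuous y) (htraj : trajectory G v y = y) :
    derivWithin (IccExtend hT.le fun t => billiardFold r (y t)) (Ici 0) 0 =
      2 * r / Real.pi * v := by
  have hy0 : y 0 = 0 := by rw [← htraj, trajectory_zero]
  have hyd : HasDerivAt y v 0 := by
    simpa [htraj, velocity] using hG.hasDerivAt_trajectory hy v 0
  have hfold : HasDerivAt (billiardFold r) (2 * r / Real.pi) (y 0) := by
    simpa [hy0, billiardSign] using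
      hasDerivAt_billiardFold r (θ := y 0) (by rw [hy0, Real.cos_zero]; exact one_ne_zero)
  refine HasDerivWithinAt.derivWithin ?_ (uniqueDiffWithinAt_Ici 0)
  refine (hfold.comp (0 : ℝ) hyd).hasDerivWithinAt.congr_of_eventuallyEq_of_mem ?_ self_mem_Ici
  filter_upwards [Icc_mem_nhdsGE hT] with u hu
  exact IccExtend_of_mem _ _ hu

theorem mainTheorem4 (T r : ℝ) (hT : 0 < T) (hr : 0 < r) (f : ℝ → ℝ → ℝ)
    (hf : IsIntegrablyBoundedCaratheodory T f) (hf' : IsIntegrablyLipschitz T f) :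
    Set.Infinite {x : Set.Icc (0 : ℝ) T → ℝ |
      IsBilliardDirichletSolution T r f (Set.IccExtend hT.le x)} := by
  intro hfin
  obtain ⟨m, hG⟩ := hf.unfoldedForce hr
  obtain ⟨B, hB⟩ :=
    (hfin.image fun x => derivWithin (IccExtend hT.le x) (Ici 0) 0).bddAbove
  have hc : 0 < 2 * r / Real.pi := by positivity
  -- As `v ≥ kπ / T - M`, this `k` gives `v > M + |B / c|` with `c = 2 * r / π`: `y` is increasing,
  -- and the initial speed `c * v` exceeds the supposed bound `B`.
  obtain ⟨k, hk⟩ := exists_nat_gt ((2 * (∫ s, m s) + |B / (2 * r / Real.pi)|) * T / Real.pi)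
  have hkN : 2 * (∫ s, m s) + |B / (2 * r / Real.pi)| < k * Real.pi / T := by
    rwa [lt_div_iff₀ hT, ← div_lt_iff₀ Real.pi_pos]
  have hM : 0 ≤ ∫ s, m s := integral_nonneg hG.bound_nonneg
  obtain ⟨v, y, hv, hy, hyT, htraj⟩ := hG.exists_trajectory_eq hT
    (N := k * Real.pi) (by linarith [abs_nonneg (B / (2 * r / Real.pi))])
  have hsol := isBilliardDirichletSolution_billiardFold hT hr hG
    (by linarith [abs_nonneg (B / (2 * r / Real.pi))]) hy hyT htraj
  have hle := hB (mem_image_of_mem _ hsol)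
  rw [derivWithin_billiardFold_trajectory hT r hG hy htraj, mul_comm, ← le_div_iff₀ hc] at hle
  linarith [le_abs_self (B / (2 * r / Real.pi))]
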